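/- Let $n\ge 0$ be an integer. A polynomial $q\in\mathbb{R}[x_1,\dots,x_m]$ is called real stable if $q=0$ or $q(x_1,\dots,x_m)\neq 0$ for all $x\in\mathbb{C}^m$ with $\operatorname{Im}(x_i)>0$ for every $i$. A polynomial $p\in\mathbb{R}[y_1,\dots,y_n,z_1,\dots,z_n]$ is called bistable if $p(y_1,\dots,y_n,-z_1,\dots,-z_n)$ is real stable. For $y,z\in\mathbb{R}^n$ with strictly positive coordinates and $\alpha\in\mathbb{R}^n$ with nonnegative coordinates, put $$\Big(\frac{yz}{\alpha}\Big)^{\alpha}=\prod_{i=1}^n\Big(\frac{y_iz_i}{\alpha_i}\Big)^{\alpha_i},$$ where the factors with $\alpha_i=0$ are taken to be $1$. Then, for every bistable polynomial $p\in\mathbb{R}[y_1,\dots,y_n,z_1,\dots,z_n]$ all of whose coefficients are nonnegative, $$\sup_{\alpha\ge 0}\ \inf_{y,z>0}\ \frac{p(y,z)}{(yz/\alpha)^{\alpha}}\;=\;\inf_{y>0}\ \sup_{\alpha\ge 0}\ \inf_{z>0}\ \frac{p(y,z)}{(yz/\alpha)^{\alpha}},$$ where $\alpha$, $y$, $z$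 range over vectors in $\mathbb{R}^n$, the inequalities are meant coordinatewise, and suprema and infima are taken in the extended real line. -/

import Mathlib

/-- A complex polynomial is stable if it is zero or has no zero all of whose coordinates lie in the
open upper half-plane. -/
def IsStable {σ : Type*} (p : MvPolynomial σ ℂ) : Prop :=
  p = 0 ∨ ∀ z : σ → ℂ, (∀ i, 0 < (z i).im) → MvPolynomial.eval z p ≠ 0

/-- A real polynomial is real stable if it is stable when regarded as a complex polynomial. -/
def IsRealStable {σ : Type*} (p : MvPolynomial σ ℝ) : Prop :=
  IsStable (MvPolynomial.map (algebraMap ℝ ℂ) p)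

/-- The polynomial `p(y, -z)`; the variables `y i` are indexed by `Sum.inl i`, the variables `z i`
by `Sum.inr i`. -/
noncomputable def negRight {ι : Type*} (p : MvPolynomial (ι ⊕ ι) ℝ) : MvPolynomial (ι ⊕ ι) ℝ :=
  MvPolynomial.aeval
    (Sum.elim (fun i => MvPolynomial.X (Sum.inl i)) (fun i => -MvPolynomial.X (Sum.inr i))) p

/-- `p(y, z)` is bistable if `p(y, -z)` is real stable. -/
def IsBistable {ι : Type*} (p : MvPolynomial (ι ⊕ ι) ℝ) : Prop :=
  IsRealStable (negRight p)

/-- `x ^ a = ∏ i, x i ^ a i` for real vectors. -/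
noncomputable def vecPow {n : ℕ} (x a : Fin n → ℝ) : ℝ := ∏ i, x i ^ a i

/-- The quotient `p(y, z) / (y z / α) ^ α`, where products and quotients of vectors are taken
coordinatewise. A coordinate with `α i = 0` contributes the factor `(y i * z i / 0) ^ 0 = 1` to the
denominator. -/
noncomputable def ratio {n : ℕ} (p : MvPolynomial (Fin n ⊕ Fin n) ℝ) (α y z : Fin n → ℝ) : ℝ :=
  MvPolynomial.eval (Sum.elim y z) p / vecPow (y * z / α) α

/-! Substitute y = e^u and z = α e^v. The quotient becomes p(e^u, α e^v) e^{-⟨α, u+v⟩} (`expRatio`).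
For fixed α ≥ 0 this is a nonnegative combination of exponentials of linear forms, hence convex in
(u, v). For fixed (u, v) it is log-concave in α as soon as p(y, ·) is log-concave on the nonnegative
orthant. Sion's minimax theorem then exchanges sup and inf over a compact convex set of α. The box
[0, deg p]^n is enough: if some α_i > deg p, sending z_i to infinity makes the infimum over z at
most 0. The nontrivial inequality follows by bounding the right side above by inf_{u,v} sup_α of
`expRatio`, exchanging, and returning to y, z.

Log-concavity is where bistability enters. For fixed y > 0 the polynomial q = p(y, ·) is stable with
nonnegative coefficients, and such a q is real-rooted on every line through a positive point
(`aeval_line_ne_zero`). On a segment inside the positive orthant, |q| is therefore a product of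
affine factors without zeros, and weighted AM-GM applies to each factor.

All limits of zero-free polynomials rest on one Harnack-type bound, in the role of Hurwitz's
theorem: it bounds the value at a point of the half-plane below by the value at a reference point,
and it survives limits. -/

open MvPolynomial in
/-- A positive-coefficient polynomial is positive at positive points. -/
theorem eval_pos_of_coeff_nonneg {σ : Type*} [Fintype σ] {q : MvPolynomial σ ℝ} (hq : q ≠ 0)
    (hc : ∀ m, 0 ≤ q.coeff m) {w : σ → ℝ} (hw : ∀ i, 0 < w i) : 0 < eval w q := by
  rw [eval_eq']
  refine Finset.sum_pos (fun m hm => mul_pos ?_ (Finset.prod_pos fun i _ => pow_pos (hw i) _))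
    (MvPolynomial.support_nonempty.2 hq)
  exact lt_of_le_of_ne (hc m) (Ne.symm (mem_support_iff.1 hm))

open MvPolynomial in
theorem eval_mono_of_coeff_nonneg {σ : Type*} [Fintype σ] {q : MvPolynomial σ ℝ}
    (hc : ∀ m, 0 ≤ q.coeff m) {w w' : σ → ℝ} (hw : ∀ i, 0 ≤ w i) (hww : ∀ i, w i ≤ w' i) :
    eval w q ≤ eval w' q := by
  rw [eval_eq', eval_eq']
  refine Finset.sum_le_sum fun m _ => mul_le_mul_of_nonneg_left ?_ (hc m)
  exact Finset.prod_le_prod (fun i _ => pow_nonneg (hw i) _)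
    fun i _ => pow_le_pow_left₀ (hw i) (hww i) _

open MvPolynomial in
theorem eval_nonneg_of_coeff_nonneg {σ : Type*} [Fintype σ] {q : MvPolynomial σ ℝ}
    (hc : ∀ m, 0 ≤ q.coeff m) {w : σ → ℝ} (hw : ∀ i, 0 ≤ w i) : 0 ≤ eval w q := by
  rw [eval_eq']
  exact Finset.sum_nonneg fun m _ =>
    mul_nonneg (hc m) (Finset.prod_nonneg fun i _ => pow_nonneg (hw i) _)

open MvPolynomial in
theorem aeval_ofReal {σ : Type*} (q : MvPolynomial σ ℝ) (w : σ → ℝ) :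
    aeval (fun i => (w i : ℂ)) q = (eval w q : ℂ) := by
  have := aeval_algebraMap_apply ℂ w q
  simpa [Function.comp_def] using this

open MvPolynomial in
theorem aeval_conj {σ : Type*} (q : MvPolynomial σ ℝ) (z : σ → ℂ) :
    aeval (fun i => (starRingEnd ℂ) (z i)) q = (starRingEnd ℂ) (aeval z q) := by
  have h : aeval (fun i => Complex.conjAe (z i)) q = Complex.conjAe (aeval z q) :=
    (comp_aeval_apply (φ := Complex.conjAe.toAlgHom) z q).symm
  exact h

/-! ### Harnack bound for polynomials zero-free in a half-plane -/

/-- Each ρ lies at distance at least Im t from t, so the triangle inequality through t costs a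
factor 1 + |t₁ - t| / Im t per root. -/
theorem norm_multiset_prod_sub_le {t t₁ : ℂ} (ht : 0 < t.im) (s : Multiset ℂ)
    (hs : ∀ ρ ∈ s, ρ.im ≤ 0) :
    ‖(s.map fun ρ => t₁ - ρ).prod‖ ≤
      (1 + ‖t₁ - t‖ / t.im) ^ s.card * ‖(s.map fun ρ => t - ρ).prod‖ := by
  induction s using Multiset.induction_on with
  | empty => simp
  | cons ρ s ih =>
    have h1 := ih fun r hr => hs r (Multiset.mem_cons_of_mem hr)
    have hρ := hs ρ (Multiset.mem_cons_self ρ s)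
    have h2 : t.im ≤ ‖t - ρ‖ := by
      have := Complex.abs_im_le_norm (t - ρ)
      rw [Complex.sub_im] at this
      linarith [le_abs_self (t.im - ρ.im)]
    have h3 : ‖t₁ - ρ‖ ≤ (1 + ‖t₁ - t‖ / t.im) * ‖t - ρ‖ := by
      calc ‖t₁ - ρ‖ = ‖(t₁ - t) + (t - ρ)‖ := by ring_nf
        _ ≤ ‖t₁ - t‖ + ‖t - ρ‖ := norm_add_le _ _
        _ = ‖t₁ - t‖ / t.im * t.im + ‖t - ρ‖ := by field_simp
        _ ≤ ‖t₁ - t‖ / t.im * ‖t - ρ‖ + ‖t - ρ‖ := by gcongr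
        _ = _ := by ring
    simp only [Multiset.map_cons, Multiset.prod_cons, Multiset.card_cons, norm_mul, pow_succ]
    calc _ ≤ ((1 + ‖t₁ - t‖ / t.im) * ‖t - ρ‖) *
          ((1 + ‖t₁ - t‖ / t.im) ^ s.card * ‖(s.map fun ρ => t - ρ).prod‖) := by gcongr
      _ = _ := by ring

/-- A Harnack-type inequality for polynomials without zeros in the upper half-plane. -/
theorem Polynomial.norm_eval_le_of_forall_im_pos_ne_zero {f : Polynomial ℂ} {D : ℕ}
    (hD : f.natDegree ≤ D) (hf : ∀ t : ℂ, 0 < t.im → f.eval t ≠ 0) {t : ℂ} (ht : 0 < t.im)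
    (t₁ : ℂ) : ‖f.eval t₁‖ ≤ (1 + ‖t₁ - t‖ / t.im) ^ D * ‖f.eval t‖ := by
  have hs := IsAlgClosed.splits f
  have hr : ∀ ρ ∈ f.roots, ρ.im ≤ 0 := fun ρ hρ => by
    by_contra! h
    exact hf ρ h (Polynomial.isRoot_of_mem_roots hρ)
  have h1 := norm_multiset_prod_sub_le (t₁ := t₁) ht f.roots hr
  have h0 : 1 ≤ 1 + ‖t₁ - t‖ / t.im := le_add_of_nonneg_right (by positivity)
  rw [hs.eval_eq_prod_roots, hs.eval_eq_prod_roots, norm_mul, norm_mul]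
  calc _ ≤ ‖f.leadingCoeff‖ * ((1 + ‖t₁ - t‖ / t.im) ^ f.roots.card *
        ‖(f.roots.map fun ρ => t - ρ).prod‖) := by gcongr
    _ ≤ ‖f.leadingCoeff‖ * ((1 + ‖t₁ - t‖ / t.im) ^ D *
        ‖(f.roots.map fun ρ => t - ρ).prod‖) := by
        gcongr
        exact (Polynomial.card_roots' f).trans hD
    _ = _ := by ring

/-- The restriction of a multivariate polynomial to the complex line `a + t b`. -/
noncomputable def linePoly {σ : Type*} (q : MvPolynomial σ ℝ) (a b : σ → ℂ) : Polynomial ℂ :=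
  MvPolynomial.aeval (fun i => Polynomial.C (a i) + Polynomial.X * Polynomial.C (b i)) q

theorem eval_linePoly {σ : Type*} (q : MvPolynomial σ ℝ) (a b : σ → ℂ) (t : ℂ) :
    (linePoly q a b).eval t = MvPolynomial.aeval (a + t • b) q := by
  have h := MvPolynomial.comp_aeval_apply (φ := (Polynomial.aeval (R := ℂ) t).restrictScalars ℝ)
    (fun i => Polynomial.C (a i) + Polynomial.X * Polynomial.C (b i)) q
  rw [linePoly, ← Polynomial.coe_aeval_eq_eval]
  refine h.trans ?_
  congr 2
  ext i
  simpa using mul_comm (b i) t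

theorem natDegree_linePoly_le {σ : Type*} (q : MvPolynomial σ ℝ) (a b : σ → ℂ) :
    (linePoly q a b).natDegree ≤ q.totalDegree := by
  have h := MvPolynomial.aeval_natDegree_le (q.map (algebraMap ℝ ℂ))
    (Finset.sup_mono (MvPolynomial.support_map_subset (algebraMap ℝ ℂ) q))
    (fun i => Polynomial.C (a i) + Polynomial.X * Polynomial.C (b i)) (n := 1)
    (fun i => by compute_degree)
  rw [MvPolynomial.aeval_map_algebraMap, mul_one] at h
  exact h

theorem norm_aeval_line_le {σ : Type*} (q : MvPolynomial σ ℝ) {a b : σ → ℂ}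
    (h : ∀ t : ℂ, 0 < t.im → MvPolynomial.aeval (a + t • b) q ≠ 0) {t : ℂ} (ht : 0 < t.im)
    (t₁ : ℂ) :
    ‖MvPolynomial.aeval (a + t₁ • b) q‖ ≤
      (1 + ‖t₁ - t‖ / t.im) ^ q.totalDegree * ‖MvPolynomial.aeval (a + t • b) q‖ := by
  simp only [← eval_linePoly] at h ⊢
  exact Polynomial.norm_eval_le_of_forall_im_pos_ne_zero (natDegree_linePoly_le q a b) h ht t₁

/-! ### Homogenization and the top-degree part -/

/-- The value at `(r, w)` of the homogenization of `q`. -/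
noncomputable def homogenizedEval {σ : Type*} [Fintype σ] (q : MvPolynomial σ ℝ) (r : ℂ)
    (w : σ → ℂ) : ℂ :=
  ∑ m ∈ q.support, ((q.coeff m : ℝ) : ℂ) * r ^ (q.totalDegree - m.degree) * ∏ i, w i ^ m i

theorem Continuous.homogenizedEval {σ T : Type*} [Fintype σ] [TopologicalSpace T]
    (q : MvPolynomial σ ℝ) {f : T → ℂ} {w : T → σ → ℂ} (hf : Continuous f)
    (hw : ∀ i, Continuous fun v => w v i) :
    Continuous fun v => homogenizedEval q (f v) (w v) := by
  unfold _root_.homogenizedEval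
  fun_prop

theorem homogenizedEval_smul {σ : Type*} [Fintype σ] (q : MvPolynomial σ ℝ) (r : ℂ)
    (w : σ → ℂ) :
    homogenizedEval q r (r • w) = r ^ q.totalDegree * MvPolynomial.aeval w q := by
  rw [homogenizedEval, MvPolynomial.aeval_def, MvPolynomial.eval₂_eq', Finset.mul_sum]
  refine Finset.sum_congr rfl fun m hm => ?_
  have h1 : m.degree ≤ q.totalDegree := by
    simpa [Finsupp.degree_eq_sum, Finsupp.sum_fintype] using MvPolynomial.le_totalDegree hm
  have h2 : r ^ q.totalDegree = r ^ (q.totalDegree - m.degree) * r ^ m.degree := by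
    rw [← pow_add, Nat.sub_add_cancel h1]
  simp only [Pi.smul_apply, smul_eq_mul, mul_pow, Finset.prod_mul_distrib, h2,
    Finset.prod_pow_eq_pow_sum, ← Finsupp.degree_eq_sum]
  simp only [Complex.coe_algebraMap]
  ring

/-- Only the monomials of top degree survive at r = 0. Their terms are positive, so nothing cancels.
-/
theorem homogenizedEval_zero_ne_zero {σ : Type*} [Fintype σ] {q : MvPolynomial σ ℝ} (hq : q ≠ 0)
    (hc : ∀ m, 0 ≤ q.coeff m) {w : σ → ℝ} (hw : ∀ i, 0 < w i) :
    homogenizedEval q 0 (fun i => (w i : ℂ)) ≠ 0 := by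
  have h : homogenizedEval q 0 (fun i => (w i : ℂ)) = ((∑ m ∈ q.support,
      q.coeff m * 0 ^ (q.totalDegree - m.degree) * ∏ i, w i ^ m i : ℝ) : ℂ) := by
    simp [homogenizedEval]
  rw [h, Complex.ofReal_ne_zero]
  have hnn : ∀ m ∈ q.support,
      0 ≤ q.coeff m * 0 ^ (q.totalDegree - m.degree) * ∏ i, w i ^ m i := fun m _ =>
    mul_nonneg (mul_nonneg (hc m) (by positivity))
      (Finset.prod_nonneg fun i _ => pow_nonneg (hw i).le _)
  obtain ⟨m, hm, hdeg⟩ := Finset.exists_mem_eq_sup q.support (MvPolynomial.support_nonempty.2 hq)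
    fun m => m.sum fun _ e => e
  have hdeg' : q.totalDegree = m.degree := by
    rw [MvPolynomial.totalDegree, hdeg]
    simp [Finsupp.degree_eq_sum, Finsupp.sum_fintype]
  refine (Finset.sum_pos' hnn ⟨m, hm, ?_⟩).ne'
  rw [hdeg', Nat.sub_self, pow_zero, mul_one]
  exact mul_pos (lt_of_le_of_ne (hc m) (Ne.symm (MvPolynomial.mem_support_iff.1 hm)))
    (Finset.prod_pos fun i _ => pow_pos (hw i) _)

/-- Supplies the real reference point for the Harnack bound: a positive point of the line, where
nonnegative coefficients rule out a zero. -/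
theorem exists_forall_pos_add_mul {σ : Type*} [Finite σ] (d : σ → ℝ) {x : σ → ℝ}
    (hx : ∀ i, 0 < x i) : ∃ t : ℝ, ∀ i, 0 < d i + t * x i := by
  obtain ⟨M, hM⟩ := (Set.finite_range fun i => -d i / x i).bddAbove
  refine ⟨M + 1, fun i => ?_⟩
  have h : -d i / x i ≤ M := hM ⟨i, rfl⟩
  rw [div_le_iff₀ (hx i)] at h
  linarith [hx i]

theorem Continuous.aeval_complex {σ T : Type*} [Fintype σ] [TopologicalSpace T]
    (q : MvPolynomial σ ℝ) {w : T → σ → ℂ} (hw : ∀ i, Continuous fun v => w v i) :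
    Continuous fun v => MvPolynomial.aeval (w v) q := by
  simp only [MvPolynomial.aeval_def, MvPolynomial.eval₂_eq']
  fun_prop

theorem norm_aeval_le_of_im_neg {σ : Type*} (q : MvPolynomial σ ℝ) {a b : σ → ℂ}
    (h : ∀ l : ℂ, l.im < 0 → MvPolynomial.aeval (fun i => a i + l * b i) q ≠ 0) {l : ℂ}
    (hl : l.im < 0) :
    ‖MvPolynomial.aeval a q‖ ≤
      (1 + ‖l‖ / -l.im) ^ q.totalDegree * ‖MvPolynomial.aeval (fun i => a i + l * b i) q‖ := by
  have e : ∀ t : ℂ, a + t • -b = fun i => a i + (-t) * b i := fun t => by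
    ext i
    simp
  have e0 : a + (0 : ℂ) • -b = a := by simp
  have := norm_aeval_line_le q (a := a) (b := -b) (fun t ht => by
    rw [e]
    exact h (-t) (by simpa using ht)) (t := -l) (by simpa using hl) 0
  rw [e0, e] at this
  simpa only [zero_sub, neg_neg, Complex.neg_im] using this

open Filter Topology in
/-- For a stable polynomial `q`, the top-degree part of `q` has no zeros with imaginary part a
positive vector. -/
theorem homogenizedEval_zero_line_ne_zero {σ : Type*} [Fintype σ] {q : MvPolynomial σ ℝ}
    (hq : q ≠ 0) (hc : ∀ m, 0 ≤ q.coeff m)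
    (hst : ∀ z : σ → ℂ, (∀ i, 0 < (z i).im) → MvPolynomial.aeval z q ≠ 0)
    (d : σ → ℝ) {x : σ → ℝ} (hx : ∀ i, 0 < x i) {t : ℂ} (ht : 0 < t.im) :
    homogenizedEval q 0 (fun i => d i + t * x i) ≠ 0 := by
  obtain ⟨t₁, ht₁⟩ := exists_forall_pos_add_mul d hx
  -- For r > 0 the homogenization is r^deg · q(·/r), so stability gives the Harnack bound with a
  -- constant independent of r; then r → 0⁺.
  have key : ∀ r : ℝ, 0 < r → ‖homogenizedEval q r (fun i => d i + t₁ * x i)‖ ≤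
      (1 + ‖(t₁ : ℂ) - t‖ / t.im) ^ q.totalDegree *
        ‖homogenizedEval q r (fun i => d i + t * x i)‖ := by
    intro r hr
    have hr' : (r : ℂ) ≠ 0 := by exact_mod_cast hr.ne'
    have e : ∀ u : ℂ, homogenizedEval q r (fun i => d i + u * x i) = (r : ℂ) ^ q.totalDegree *
        MvPolynomial.aeval ((fun i => ((d i / r : ℝ) : ℂ)) + u • fun i => ((x i / r : ℝ) : ℂ)) q := by
      intro u
      rw [← homogenizedEval_smul]
      congr 1
      ext i
      simp only [Pi.smul_apply, Pi.add_apply, smul_eq_mul]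
      push_cast
      field_simp
    rw [e, e, norm_mul, norm_mul, mul_left_comm]
    refine mul_le_mul_of_nonneg_left (norm_aeval_line_le q (fun u hu => hst _ fun i => ?_) ht _)
      (norm_nonneg _)
    simp only [Pi.smul_apply, Pi.add_apply, smul_eq_mul, Complex.add_im, Complex.ofReal_im,
      Complex.im_mul_ofReal, zero_add]
    exact mul_pos hu (div_pos (hx i) hr)
  have hcont : ∀ w : σ → ℂ, Continuous fun r : ℝ => ‖homogenizedEval q r w‖ := fun w =>
    (Continuous.homogenizedEval q (by fun_prop) fun i => by fun_prop).norm
  have hlim := le_of_tendsto_of_tendsto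
    (((hcont fun i => d i + t₁ * x i).tendsto 0).mono_left nhdsWithin_le_nhds)
    ((((hcont fun i => d i + t * x i).const_mul
      ((1 + ‖(t₁ : ℂ) - t‖ / t.im) ^ q.totalDegree)).tendsto 0).mono_left nhdsWithin_le_nhds)
    (eventually_nhdsWithin_of_forall (s := Set.Ioi 0) key)
  intro h0
  rw [Complex.ofReal_zero, h0, norm_zero, mul_zero] at hlim
  have h1 := homogenizedEval_zero_ne_zero hq hc ht₁
  push_cast at h1
  exact h1 (norm_le_zero_iff.1 hlim)

/-! ### Real-rootedness along lines through a positive point -/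

theorem isClosed_setOf_exists_mem_eq_zero {K : Set ℂ} (hK : IsCompact K) {F : ℝ × ℂ → ℂ}
    (hF : Continuous F) : IsClosed {s : ℝ | ∃ l ∈ K, F (s, l) = 0} := by
  have : CompactSpace K := isCompact_iff_compactSpace.1 hK
  have h : IsClosed {v : ℝ × K | F (v.1, v.2) = 0} := isClosed_eq (by fun_prop) continuous_const
  convert isClosedMap_fst_of_compactSpace _ h using 1
  ext s
  simp

theorem aeval_ne_zero_of_im_neg {σ : Type*} {q : MvPolynomial σ ℝ}
    (hst : ∀ z : σ → ℂ, (∀ i, 0 < (z i).im) → MvPolynomial.aeval z q ≠ 0)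
    {z : σ → ℂ} (hz : ∀ i, (z i).im < 0) : MvPolynomial.aeval z q ≠ 0 := by
  intro h
  refine hst (fun i => starRingEnd ℂ (z i)) (fun i => ?_) ?_
  · simpa using hz i
  · rw [aeval_conj, h, map_zero]

/-- The half-plane is not compact, so it is covered by the half-discs |l| ≤ 1 and |u| ≤ 1 with u =
1/l. In the second chart the equation is homogenized. The added point u = 0 is never a solution,
because the top-degree part does not vanish at s d + i r x. -/
theorem isClosed_setOf_perturbed_line_eq_zero {σ : Type*} [Fintype σ] {q : MvPolynomial σ ℝ}
    (hq : q ≠ 0) (hc : ∀ m, 0 ≤ q.coeff m)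
    (hst : ∀ z : σ → ℂ, (∀ i, 0 < (z i).im) → MvPolynomial.aeval z q ≠ 0)
    (d : σ → ℝ) {x : σ → ℝ} (hx : ∀ i, 0 < x i) {r : ℝ} (hr : 0 < r) :
    IsClosed {s : ℝ | ∃ l : ℂ, l.im ≤ 0 ∧ MvPolynomial.aeval
      (fun i => (x i : ℂ) + l * (s * d i + Complex.I * r * x i)) q = 0} := by
  have hU : Continuous fun v : ℝ × ℂ => MvPolynomial.aeval
      (fun i => (x i : ℂ) + v.2 * (v.1 * d i + Complex.I * r * x i)) q :=
    Continuous.aeval_complex q fun i => by fun_prop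
  have hV : Continuous fun v : ℝ × ℂ => homogenizedEval q v.2
      (fun i => v.2 * x i + (v.1 * d i + Complex.I * r * x i)) :=
    Continuous.homogenizedEval q (by fun_prop) fun i => by fun_prop
  have h1 : {s : ℝ | ∃ l : ℂ, l.im ≤ 0 ∧ MvPolynomial.aeval
      (fun i => (x i : ℂ) + l * (s * d i + Complex.I * r * x i)) q = 0} =
      {s : ℝ | ∃ l ∈ Metric.closedBall (0 : ℂ) 1 ∩ {l | l.im ≤ 0},
        MvPolynomial.aeval
        (fun i => (x i : ℂ) + l * (s * d i + Complex.I * r * x i)) q = 0} ∪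
      {s : ℝ | ∃ u ∈ Metric.closedBall (0 : ℂ) 1 ∩ {l | 0 ≤ l.im}, homogenizedEval q u
        (fun i => u * x i + (s * d i + Complex.I * r * x i)) = 0} := by
    have hinv : ∀ (s : ℝ) (u : ℂ), u ≠ 0 →
        homogenizedEval q u (fun i => u * x i + (s * d i + Complex.I * r * x i)) =
        u ^ q.totalDegree * MvPolynomial.aeval
          (fun i => (x i : ℂ) + u⁻¹ * (s * d i + Complex.I * r * x i)) q := by
      intro s u hu
      rw [← homogenizedEval_smul]
      congr 1
      ext i
      simp only [Pi.smul_apply, smul_eq_mul]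
      field_simp
    ext s
    constructor
    · rintro ⟨l, hl, h0⟩
      rcases le_total ‖l‖ 1 with h | h
      · exact Or.inl ⟨l, ⟨by simpa using h, hl⟩, h0⟩
      · have hl0 : l ≠ 0 := norm_pos_iff.1 (zero_lt_one.trans_le h)
        refine Or.inr ⟨l⁻¹, ⟨by simpa using inv_le_one_of_one_le₀ h, ?_⟩, ?_⟩
        · rw [Set.mem_ofPred_eq, Complex.inv_im]
          exact div_nonneg (neg_nonneg.2 hl) (Complex.normSq_nonneg _)
        · rw [hinv _ _ (inv_ne_zero hl0), inv_inv, h0, mul_zero]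
    · rintro (⟨l, ⟨-, hl⟩, h0⟩ | ⟨u, ⟨-, hu⟩, h0⟩)
      · exact ⟨l, hl, h0⟩
      · have hu0 : u ≠ 0 := by
          rintro rfl
          have := homogenizedEval_zero_line_ne_zero hq hc hst (fun i => s * d i) hx
            (t := Complex.I * r) (by simpa using hr)
          apply this
          simpa using h0
        refine ⟨u⁻¹, ?_, ?_⟩
        · rw [Complex.inv_im]
          exact div_nonpos_of_nonpos_of_nonneg (neg_nonpos.2 hu) (Complex.normSq_nonneg _)
        · rw [hinv _ _ hu0] at h0
          exact (mul_eq_zero.1 h0).resolve_left (pow_ne_zero _ hu0)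
  rw [h1]
  refine IsClosed.union ?_ ?_
  · exact isClosed_setOf_exists_mem_eq_zero ((isCompact_closedBall _ _).inter_right
      (isClosed_le Complex.continuous_im continuous_const)) hU
  · exact isClosed_setOf_exists_mem_eq_zero ((isCompact_closedBall _ _).inter_right
      (isClosed_le continuous_const Complex.continuous_im)) hV

/-- Every point here is (1 + i r l) x. If Re l ≠ 0 all imaginary parts share one strict sign; if Re
l = 0 the factor is real and at least 1. -/
theorem aeval_perturbed_ray_ne_zero {σ : Type*} [Fintype σ] {q : MvPolynomial σ ℝ}
    (hq : q ≠ 0) (hc : ∀ m, 0 ≤ q.coeff m)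
    (hst : ∀ z : σ → ℂ, (∀ i, 0 < (z i).im) → MvPolynomial.aeval z q ≠ 0)
    {x : σ → ℝ} (hx : ∀ i, 0 < x i) {r : ℝ} (hr : 0 < r) {l : ℂ} (hl : l.im ≤ 0) :
    MvPolynomial.aeval (fun i => (x i : ℂ) + l * (Complex.I * r * x i)) q ≠ 0 := by
  intro h0
  have e : (fun i => (x i : ℂ) + l * (Complex.I * r * x i)) =
      fun i => (1 + l * (Complex.I * r)) * x i := by
    ext i
    ring
  rw [e] at h0
  have him : ∀ i, ((1 + l * (Complex.I * r)) * x i).im = l.re * r * x i := by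
    intro i; simp
  rcases lt_trichotomy l.re 0 with h | h | h
  · refine aeval_ne_zero_of_im_neg hst (fun i => ?_) h0
    rw [him]
    exact mul_neg_of_neg_of_pos (mul_neg_of_neg_of_pos h hr) (hx i)
  · obtain ⟨u, rfl⟩ : ∃ u : ℝ, l = Complex.I * u :=
      ⟨l.im, Complex.ext (by simpa using h) (by simp)⟩
    have hu : u ≤ 0 := by simpa using hl
    have e2 : (fun i => (1 + Complex.I * u * (Complex.I * r)) * (x i : ℂ)) =
        fun i => (((1 - u * r) * x i : ℝ) : ℂ) := by
      ext i
      push_cast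
      linear_combination ((u : ℂ) * r * x i) * Complex.I_mul_I
    rw [e2, aeval_ofReal, Complex.ofReal_eq_zero] at h0
    refine (eval_pos_of_coeff_nonneg hq hc fun i => mul_pos ?_ (hx i)).ne' h0
    nlinarith
  · refine hst _ (fun i => ?_) h0
    rw [him]
    exact mul_pos (mul_pos h hr) (hx i)

/-- The perturbed line through `x` used in the proof of real-rootedness. -/
theorem aeval_perturbed_line_ne_zero {σ : Type*} [Fintype σ] {q : MvPolynomial σ ℝ}
    (hq : q ≠ 0) (hc : ∀ m, 0 ≤ q.coeff m)
    (hst : ∀ z : σ → ℂ, (∀ i, 0 < (z i).im) → MvPolynomial.aeval z q ≠ 0)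
    (d : σ → ℝ) {x : σ → ℝ} (hx : ∀ i, 0 < x i) {r : ℝ} (hr : 0 < r) (s : ℝ) {l : ℂ}
    (hl : l.im ≤ 0) :
    MvPolynomial.aeval (fun i => (x i : ℂ) + l * (s * d i + Complex.I * r * x i)) q ≠ 0 := by
  have hx0 : MvPolynomial.aeval (fun i => (x i : ℂ)) q ≠ 0 := by
    rw [aeval_ofReal, Complex.ofReal_ne_zero]
    exact (eval_pos_of_coeff_nonneg hq hc hx).ne'
  -- No zero can cross the real axis: for real l ≠ 0 all imaginary parts l r x_i have the same sign.
  have hreal : ∀ (s l : ℝ), MvPolynomial.aeval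
      (fun i => (x i : ℂ) + l * (s * d i + Complex.I * r * x i)) q ≠ 0 := by
    intro s l
    have him : ∀ i, ((x i : ℂ) + l * (s * d i + Complex.I * r * x i)).im = l * (r * x i) := by
      intro i; simp
    rcases lt_trichotomy l 0 with h | h | h
    · refine aeval_ne_zero_of_im_neg hst fun i => ?_
      rw [him]
      exact mul_neg_of_neg_of_pos h (mul_pos hr (hx i))
    · simpa [h] using hx0
    · refine hst _ fun i => ?_
      rw [him]
      exact mul_pos h (mul_pos hr (hx i))
  set B : Set ℝ := {s | ∃ l : ℂ, l.im ≤ 0 ∧ MvPolynomial.aeval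
    (fun i => (x i : ℂ) + l * (s * d i + Complex.I * r * x i)) q = 0} with hB
  have hcl : IsClosed B := isClosed_setOf_perturbed_line_eq_zero hq hc hst d hx hr
  -- The complement is cut out by the Harnack inequalities, which are closed conditions in s.
  -- Conversely they force nonvanishing for Im l < 0, and `hreal` covers Im l = 0.
  have hop : IsOpen B := by
    have h1 : Bᶜ = ⋂ (l : ℂ) (_ : l.im < 0), {s : ℝ | ‖MvPolynomial.aeval
        (fun i => (x i : ℂ)) q‖ ≤ (1 + ‖l‖ / -l.im) ^ q.totalDegree * ‖MvPolynomial.aeval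
          (fun i => (x i : ℂ) + l * (s * d i + Complex.I * r * x i)) q‖} := by
      ext s
      simp only [hB, Set.mem_compl_iff, Set.mem_ofPred_eq, not_exists, not_and, Set.mem_iInter]
      constructor
      · intro h l hl
        exact norm_aeval_le_of_im_neg q (a := fun i => (x i : ℂ))
          (b := fun i => s * d i + Complex.I * r * x i) (fun l hl h0 => h l hl.le h0) hl
      · intro h l hl h0
        rcases hl.lt_or_eq with hl | hl
        · have := h l hl
          rw [h0, norm_zero, mul_zero] at this
          exact hx0 (norm_le_zero_iff.1 this)
        · have hl' : l = (l.re : ℂ) := Complex.ext rfl (by simpa using hl)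
          rw [hl'] at h0
          exact hreal s l.re h0
    rw [← isClosed_compl_iff, h1]
    refine isClosed_iInter fun l => isClosed_iInter fun _ => isClosed_le continuous_const ?_
    exact continuous_const.mul (Continuous.aeval_complex q fun i => by fun_prop).norm
  have h0 : (0 : ℝ) ∉ B := by
    rintro ⟨l, hl, h0⟩
    exact aeval_perturbed_ray_ne_zero hq hc hst hx hr hl (by simpa using h0)
  -- ℝ is connected and s = 0 is not a bad parameter.
  have hBe : B = ∅ := by
    refine (isClopen_iff.1 ⟨hcl, hop⟩).resolve_right fun h => h0 ?_
    rw [h]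
    exact Set.mem_univ _
  intro h
  have hs : s ∈ B := ⟨l, hl, h⟩
  rw [hBe] at hs
  exact hs

open Filter Topology in
-- Limit r → 0⁺ of the perturbed line with s = 1; the Harnack constant does not depend on r.
theorem aeval_line_ne_zero_of_im_neg {σ : Type*} [Fintype σ] {q : MvPolynomial σ ℝ}
    (hq : q ≠ 0) (hc : ∀ m, 0 ≤ q.coeff m)
    (hst : ∀ z : σ → ℂ, (∀ i, 0 < (z i).im) → MvPolynomial.aeval z q ≠ 0)
    (d : σ → ℝ) {x : σ → ℝ} (hx : ∀ i, 0 < x i) {l : ℂ} (hl : l.im < 0) :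
    MvPolynomial.aeval (fun i => (x i : ℂ) + l * d i) q ≠ 0 := by
  have hx0 : MvPolynomial.aeval (fun i => (x i : ℂ)) q ≠ 0 := by
    rw [aeval_ofReal, Complex.ofReal_ne_zero]
    exact (eval_pos_of_coeff_nonneg hq hc hx).ne'
  have key : ∀ r : ℝ, 0 < r → ‖MvPolynomial.aeval (fun i => (x i : ℂ)) q‖ ≤
      (1 + ‖l‖ / -l.im) ^ q.totalDegree *
        ‖MvPolynomial.aeval (fun i => (x i : ℂ) + l * (d i + Complex.I * r * x i)) q‖ := by
    intro r hr
    refine norm_aeval_le_of_im_neg q (a := fun i => (x i : ℂ))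
      (b := fun i => d i + Complex.I * r * x i) (fun l hl => ?_) hl
    simpa using aeval_perturbed_line_ne_zero hq hc hst d hx hr 1 hl.le
  have hcont : Continuous fun r : ℝ => (1 + ‖l‖ / -l.im) ^ q.totalDegree *
      ‖MvPolynomial.aeval (fun i => (x i : ℂ) + l * (d i + Complex.I * r * x i)) q‖ :=
    continuous_const.mul (Continuous.aeval_complex q fun i => by fun_prop).norm
  have hlim := ge_of_tendsto ((hcont.tendsto 0).mono_left nhdsWithin_le_nhds)
    (eventually_nhdsWithin_of_forall (s := Set.Ioi 0) key)
  intro h0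
  simp only [Complex.ofReal_zero, mul_zero, zero_mul, add_zero, h0, norm_zero] at hlim
  exact hx0 (norm_le_zero_iff.1 hlim)

/-- Restricted to a line through a positive point, a stable polynomial with nonnegative
coefficients is real-rooted. -/
theorem aeval_line_ne_zero {σ : Type*} [Fintype σ] {q : MvPolynomial σ ℝ}
    (hq : q ≠ 0) (hc : ∀ m, 0 ≤ q.coeff m)
    (hst : ∀ z : σ → ℂ, (∀ i, 0 < (z i).im) → MvPolynomial.aeval z q ≠ 0)
    (d : σ → ℝ) {x : σ → ℝ} (hx : ∀ i, 0 < x i) {l : ℂ} (hl : l.im ≠ 0) :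
    MvPolynomial.aeval (fun i => (x i : ℂ) + l * d i) q ≠ 0 := by
  rcases hl.lt_or_gt with h | h
  · exact aeval_line_ne_zero_of_im_neg hq hc hst d hx h
  · simpa using aeval_line_ne_zero_of_im_neg hq hc hst (fun i => -d i) hx (l := -l) (by simpa using h)

/-! ### Log-concavity on the positive orthant -/

/-- A real ρ outside [0, 1] makes |t - ρ| affine in t on [0, 1], so its value at b is the weighted
arithmetic mean of its values at 0 and 1. AM-GM is applied to each factor. -/
theorem rpow_norm_multiset_prod_le {a b : ℝ} (ha : 0 < a) (hb : 0 < b) (hab : a + b = 1)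
    (s : Multiset ℂ) (hs : ∀ ρ ∈ s, ρ.im = 0 ∧ ∀ t ∈ Set.Icc (0 : ℝ) 1, (t : ℂ) ≠ ρ) :
    ‖(s.map fun ρ => 0 - ρ).prod‖ ^ a * ‖(s.map fun ρ => 1 - ρ).prod‖ ^ b ≤
      ‖(s.map fun ρ => (b : ℂ) - ρ).prod‖ := by
  induction s using Multiset.induction_on with
  | empty => simp
  | cons ρ s ih =>
    have h1 := ih fun r hr => hs r (Multiset.mem_cons_of_mem hr)
    obtain ⟨him, hne⟩ := hs ρ (Multiset.mem_cons_self ρ s)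
    have hρ : ρ = (ρ.re : ℂ) := Complex.ext rfl (by simpa using him)
    have h2 : ‖0 - ρ‖ ^ a * ‖1 - ρ‖ ^ b ≤ ‖(b : ℂ) - ρ‖ := by
      refine (Real.geom_mean_le_arith_mean2_weighted ha.le hb.le (norm_nonneg _) (norm_nonneg _)
        hab).trans_eq ?_
      have hr : ρ.re < 0 ∨ 1 < ρ.re := by
        by_contra! h
        exact hne ρ.re ⟨h.1, h.2⟩ hρ.symm
      rw [hρ, ← Complex.ofReal_zero, ← Complex.ofReal_one, ← Complex.ofReal_sub,
        ← Complex.ofReal_sub, ← Complex.ofReal_sub, Complex.norm_real, Complex.norm_real,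
        Complex.norm_real, Real.norm_eq_abs, Real.norm_eq_abs, Real.norm_eq_abs]
      have ha' : a = 1 - b := by linarith
      rcases hr with h | h
      · rw [abs_of_pos (by linarith), abs_of_pos (by linarith), abs_of_pos (by linarith), ha']
        ring
      · rw [abs_of_neg (by linarith), abs_of_neg (by linarith), abs_of_neg (by linarith), ha']
        ring
    simp only [Multiset.map_cons, Multiset.prod_cons, norm_mul]
    rw [Real.mul_rpow (norm_nonneg _) (norm_nonneg _), Real.mul_rpow (norm_nonneg _) (norm_nonneg _)]
    calc _ = (‖0 - ρ‖ ^ a * ‖1 - ρ‖ ^ b) * (‖(s.map fun ρ => 0 - ρ).prod‖ ^ a *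
          ‖(s.map fun ρ => 1 - ρ).prod‖ ^ b) := by ring
      _ ≤ _ := by gcongr

theorem Polynomial.rpow_norm_eval_mul_le {f : Polynomial ℂ} {a b : ℝ} (ha : 0 < a) (hb : 0 < b)
    (hab : a + b = 1) (hf : ∀ t : ℂ, t.im ≠ 0 → f.eval t ≠ 0)
    (hf' : ∀ t ∈ Set.Icc (0 : ℝ) 1, f.eval (t : ℂ) ≠ 0) :
    ‖f.eval 0‖ ^ a * ‖f.eval 1‖ ^ b ≤ ‖f.eval (b : ℂ)‖ := by
  have hs := IsAlgClosed.splits f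
  have hr : ∀ ρ ∈ f.roots, ρ.im = 0 ∧ ∀ t ∈ Set.Icc (0 : ℝ) 1, (t : ℂ) ≠ ρ := fun ρ hρ => by
    have h0 : f.eval ρ = 0 := Polynomial.isRoot_of_mem_roots hρ
    refine ⟨by_contra fun h => hf ρ h h0, ?_⟩
    rintro t ht rfl
    exact hf' t ht h0
  have h1 := rpow_norm_multiset_prod_le ha hb hab f.roots hr
  rw [hs.eval_eq_prod_roots, hs.eval_eq_prod_roots, hs.eval_eq_prod_roots, norm_mul, norm_mul,
    norm_mul, Real.mul_rpow (norm_nonneg _) (norm_nonneg _),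
    Real.mul_rpow (norm_nonneg _) (norm_nonneg _)]
  have h2 : ‖f.leadingCoeff‖ ^ a * ‖f.leadingCoeff‖ ^ b = ‖f.leadingCoeff‖ := by
    rw [← Real.rpow_add_of_nonneg (norm_nonneg _) ha.le hb.le, hab, Real.rpow_one]
  calc _ = (‖f.leadingCoeff‖ ^ a * ‖f.leadingCoeff‖ ^ b) *
        (‖(f.roots.map fun ρ => 0 - ρ).prod‖ ^ a * ‖(f.roots.map fun ρ => 1 - ρ).prod‖ ^ b) := by
        ring
    _ ≤ _ := by rw [h2]; gcongr

/-- A stable polynomial with nonnegative coefficients is log-concave on the open orthant. -/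
theorem rpow_eval_mul_rpow_eval_le {σ : Type*} [Fintype σ] {q : MvPolynomial σ ℝ}
    (hq : q ≠ 0) (hc : ∀ m, 0 ≤ q.coeff m)
    (hst : ∀ z : σ → ℂ, (∀ i, 0 < (z i).im) → MvPolynomial.aeval z q ≠ 0)
    {x y : σ → ℝ} (hx : ∀ i, 0 < x i) (hy : ∀ i, 0 < y i) {a b : ℝ} (ha : 0 < a) (hb : 0 < b)
    (hab : a + b = 1) :
    MvPolynomial.eval x q ^ a * MvPolynomial.eval y q ^ b ≤
      MvPolynomial.eval (a • x + b • y) q := by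
  have hpos : ∀ t ∈ Set.Icc (0 : ℝ) 1, 0 < MvPolynomial.eval (fun i => x i + t * (y i - x i)) q := by
    intro t ht
    refine eval_pos_of_coeff_nonneg hq hc fun i => ?_
    have h1 : x i + t * (y i - x i) = (1 - t) * x i + t * y i := by ring
    rw [h1]
    rcases ht.1.eq_or_lt with h | h
    · simpa [← h] using hx i
    · exact add_pos_of_nonneg_of_pos (mul_nonneg (sub_nonneg.2 ht.2) (hx i).le) (mul_pos h (hy i))
  have hev : ∀ t : ℂ, (linePoly q (fun i => (x i : ℂ)) fun i => ((y i - x i : ℝ) : ℂ)).eval t =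
      MvPolynomial.aeval (fun i => (x i : ℂ) + t * (y i - x i : ℝ)) q := fun t =>
    eval_linePoly q _ _ t
  have hevr : ∀ t : ℝ, (linePoly q (fun i => (x i : ℂ)) fun i => ((y i - x i : ℝ) : ℂ)).eval
      (t : ℂ) = (MvPolynomial.eval (fun i => x i + t * (y i - x i)) q : ℝ) := fun t => by
    rw [hev, ← aeval_ofReal]
    push_cast
    rfl
  have h := Polynomial.rpow_norm_eval_mul_le
    (f := linePoly q (fun i => (x i : ℂ)) fun i => ((y i - x i : ℝ) : ℂ)) ha hb hab
    (fun t ht => by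
      rw [hev]
      exact aeval_line_ne_zero hq hc hst _ hx ht)
    (fun t ht => by
      rw [hevr, Complex.ofReal_ne_zero]
      exact (hpos t ht).ne')
  rw [← Complex.ofReal_zero, ← Complex.ofReal_one, hevr, hevr, hevr, Complex.norm_real,
    Complex.norm_real, Complex.norm_real, Real.norm_of_nonneg (hpos 0 (by simp)).le,
    Real.norm_of_nonneg (hpos 1 (by simp)).le, Real.norm_of_nonneg
      (hpos b ⟨hb.le, by linarith⟩).le] at h
  have e : a • x + b • y = fun i => x i + b * (y i - x i) := by
    ext i
    simp only [Pi.add_apply, Pi.smul_apply, smul_eq_mul]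
    linear_combination x i * hab
  rw [e]
  simpa using h

/-! ### Fixing y in a bistable polynomial -/

open MvPolynomial in
/-- The polynomial in `z` obtained from `p(y, z)` by fixing `y`. -/
noncomputable def partialEval {ι : Type*} (y : ι → ℝ) (p : MvPolynomial (ι ⊕ ι) ℝ) :
    MvPolynomial ι ℝ :=
  aeval (Sum.elim (fun i => C (y i)) X) p

open MvPolynomial in
theorem aeval_partialEval {ι A : Type*} [CommSemiring A] [Algebra ℝ A] (y : ι → ℝ)
    (p : MvPolynomial (ι ⊕ ι) ℝ) (z : ι → A) :
    aeval z (partialEval y p) = aeval (Sum.elim (fun i => algebraMap ℝ A (y i)) z) p := by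
  rw [partialEval, comp_aeval_apply]
  congr 2
  ext i
  cases i <;> simp

theorem eval_partialEval {ι : Type*} (y : ι → ℝ) (p : MvPolynomial (ι ⊕ ι) ℝ) (z : ι → ℝ) :
    MvPolynomial.eval z (partialEval y p) = MvPolynomial.eval (Sum.elim y z) p := by
  simpa [MvPolynomial.coe_aeval_eq_eval] using aeval_partialEval y p z

open MvPolynomial in
theorem coeff_mul_nonneg {σ : Type*} {f g : MvPolynomial σ ℝ} (hf : ∀ m, 0 ≤ f.coeff m)
    (hg : ∀ m, 0 ≤ g.coeff m) (m : σ →₀ ℕ) : 0 ≤ (f * g).coeff m := by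
  classical
  rw [coeff_mul]
  exact Finset.sum_nonneg fun x _ => mul_nonneg (hf _) (hg _)

open MvPolynomial in
theorem coeff_one_nonneg {σ : Type*} (m : σ →₀ ℕ) : 0 ≤ (1 : MvPolynomial σ ℝ).coeff m := by
  classical
  rw [coeff_one]
  split_ifs <;> simp

open MvPolynomial in
theorem coeff_C_nonneg {σ : Type*} {c : ℝ} (hc : 0 ≤ c) (m : σ →₀ ℕ) :
    0 ≤ (C c : MvPolynomial σ ℝ).coeff m := by
  classical
  rw [coeff_C]
  split_ifs <;> simp [hc]

open MvPolynomial in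
theorem coeff_partialEval_nonneg {ι : Type*} [Fintype ι] {y : ι → ℝ} (hy : ∀ i, 0 ≤ y i)
    {p : MvPolynomial (ι ⊕ ι) ℝ} (hc : ∀ m, 0 ≤ p.coeff m) (m : ι →₀ ℕ) :
    0 ≤ (partialEval y p).coeff m := by
  classical
  rw [partialEval, aeval_def, eval₂_eq', coeff_sum]
  refine Finset.sum_nonneg fun k _ => coeff_mul_nonneg (coeff_C_nonneg (hc k)) ?_ m
  refine Finset.prod_induction _ (fun f : MvPolynomial ι ℝ => ∀ m, 0 ≤ f.coeff m)
    (fun f g => coeff_mul_nonneg) coeff_one_nonneg fun i _ => ?_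
  induction k i with
  | zero => simpa using coeff_one_nonneg
  | succ e ih =>
    rw [pow_succ]
    refine coeff_mul_nonneg ih ?_
    cases i with
    | inl j => exact coeff_C_nonneg (hy j)
    | inr j =>
      intro m
      simp only [Sum.elim_inr, coeff_X]
      split_ifs <;> simp

open MvPolynomial in
theorem aeval_negRight {ι A : Type*} [CommRing A] [Algebra ℝ A] (p : MvPolynomial (ι ⊕ ι) ℝ)
    (y z : ι → A) : aeval (Sum.elim y z) (negRight p) = aeval (Sum.elim y (-z)) p := by
  rw [negRight, comp_aeval_apply]
  congr 2
  ext i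
  cases i <;> simp

theorem IsBistable.aeval_ne_zero {ι : Type*} [Fintype ι] {p : MvPolynomial (ι ⊕ ι) ℝ}
    (hp : IsBistable p) (hp0 : p ≠ 0) (hc : ∀ m, 0 ≤ p.coeff m) {y z : ι → ℂ}
    (hy : ∀ i, (y i).im < 0) (hz : ∀ i, 0 < (z i).im) :
    MvPolynomial.aeval (Sum.elim y z) p ≠ 0 := by
  have key : ∀ y z : ι → ℂ, (∀ i, 0 < (y i).im) → (∀ i, (z i).im < 0) →
      MvPolynomial.aeval (Sum.elim y z) p ≠ 0 := by
    intro y z hy hz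
    rcases hp with h | h
    -- The zero alternative is excluded by evaluating p at the all-ones point.
    · have h1 : negRight p = 0 :=
        (map_eq_zero_iff _ (MvPolynomial.map_injective (algebraMap ℝ ℂ) (algebraMap ℝ ℂ).injective)).1 h
      have h2 := aeval_negRight (A := ℝ) p 1 (-1)
      have h3 : 0 = MvPolynomial.eval (Sum.elim 1 1) p := by
        simpa [h1, MvPolynomial.coe_aeval_eq_eval] using h2
      exact absurd h3 (eval_pos_of_coeff_nonneg hp0 hc fun i => by cases i <;> simp).ne
    · have h1 := h (Sum.elim y (-z)) fun i => by
        cases i with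
        | inl j => exact hy j
        | inr j => simpa using hz j
      rw [MvPolynomial.eval_map, ← MvPolynomial.aeval_def, aeval_negRight, neg_neg] at h1
      exact h1
  intro h0
  refine key (fun i => starRingEnd ℂ (y i)) (fun i => starRingEnd ℂ (z i))
    (fun i => by simpa using hy i) (fun i => by simpa using hz i) ?_
  have e : (Sum.elim (fun i => starRingEnd ℂ (y i)) fun i => starRingEnd ℂ (z i)) =
      fun i => starRingEnd ℂ (Sum.elim y z i) := by
    ext i
    cases i <;> rfl
  rw [e, aeval_conj, h0, map_zero]

open Filter Topology in
-- A real y is the boundary limit of y - i r, where bistability applies. The Harnack bound in the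
-- z-direction, compared with a positive real point, is uniform as r → 0⁺.
theorem IsBistable.aeval_partialEval_ne_zero {ι : Type*} [Fintype ι]
    {p : MvPolynomial (ι ⊕ ι) ℝ} (hp : IsBistable p) (hp0 : p ≠ 0) (hc : ∀ m, 0 ≤ p.coeff m)
    {y : ι → ℝ} (hy : ∀ i, 0 < y i) (z : ι → ℂ) (hz : ∀ i, 0 < (z i).im) :
    MvPolynomial.aeval z (partialEval y p) ≠ 0 := by
  rw [aeval_partialEval]
  obtain ⟨t₁, ht₁⟩ := exists_forall_pos_add_mul (fun i => (z i).re) hz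
  have key : ∀ r : ℝ, 0 < r →
      ‖MvPolynomial.aeval (Sum.elim (fun i => (y i : ℂ) - Complex.I * r)
        (fun i => ((z i).re : ℂ) + t₁ * (z i).im)) p‖ ≤
      (1 + ‖(t₁ : ℂ) - Complex.I‖ / Complex.I.im) ^ p.totalDegree *
        ‖MvPolynomial.aeval (Sum.elim (fun i => (y i : ℂ) - Complex.I * r)
        (fun i => ((z i).re : ℂ) + Complex.I * (z i).im)) p‖ := by
    intro r hr
    have e : ∀ t : ℂ, Sum.elim (fun i => (y i : ℂ) - Complex.I * r)
        (fun i => ((z i).re : ℂ) + t * (z i).im) =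
        Sum.elim (fun i => (y i : ℂ) - Complex.I * r) (fun i => ((z i).re : ℂ)) +
          t • Sum.elim (fun _ => (0 : ℂ)) (fun i => ((z i).im : ℂ)) := by
      intro t
      ext i
      cases i <;> simp
    rw [e, e]
    refine norm_aeval_line_le p (fun t ht => ?_) (by simp) _
    rw [← e]
    exact hp.aeval_ne_zero hp0 hc (fun i => by simpa using hr)
      (fun i => by simpa using mul_pos ht (hz i))
  have hcont : ∀ w : ι → ℂ, Continuous fun r : ℝ =>
      ‖MvPolynomial.aeval (Sum.elim (fun i => (y i : ℂ) - Complex.I * r) w) p‖ := fun w =>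
    (Continuous.aeval_complex p fun i => by cases i <;> simp <;> fun_prop).norm
  have hlim := le_of_tendsto_of_tendsto
    (((hcont _).tendsto 0).mono_left nhdsWithin_le_nhds)
    ((((hcont _).const_mul _).tendsto 0).mono_left nhdsWithin_le_nhds)
    (eventually_nhdsWithin_of_forall (s := Set.Ioi 0) key)
  intro h0
  have e1 : (Sum.elim (fun i => (y i : ℂ) - Complex.I * (0 : ℝ))
      (fun i => ((z i).re : ℂ) + Complex.I * (z i).im)) =
      Sum.elim (fun i => algebraMap ℝ ℂ (y i)) z := by
    ext i
    cases i with
    | inl j => simp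
    | inr j => simpa [mul_comm] using Complex.re_add_im (z j)
  have e2 : (Sum.elim (fun i => (y i : ℂ) - Complex.I * (0 : ℝ))
      (fun i => ((z i).re : ℂ) + t₁ * (z i).im)) =
      fun i => ((Sum.elim y (fun i => (z i).re + t₁ * (z i).im) i : ℝ) : ℂ) := by
    ext i
    cases i <;> simp
  rw [e1, h0, norm_zero, mul_zero, e2, aeval_ofReal] at hlim
  refine (eval_pos_of_coeff_nonneg hp0 hc (w := Sum.elim y fun i => (z i).re + t₁ * (z i).im)
    fun i => ?_).ne' (by exact_mod_cast norm_le_zero_iff.1 hlim)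
  cases i with
  | inl j => exact hy j
  | inr j => exact ht₁ j

open Filter Topology in
/-- A bistable polynomial with nonnegative coefficients is log-concave in `z` for each fixed
positive `y`. -/
theorem IsBistable.rpow_eval_mul_rpow_eval_le {ι : Type*} [Fintype ι]
    {p : MvPolynomial (ι ⊕ ι) ℝ} (hp : IsBistable p) (hc : ∀ m, 0 ≤ p.coeff m)
    {y : ι → ℝ} (hy : ∀ i, 0 < y i) {w x : ι → ℝ} (hw : ∀ i, 0 ≤ w i) (hx : ∀ i, 0 ≤ x i)
    {a b : ℝ} (ha : 0 < a) (hb : 0 < b) (hab : a + b = 1) :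
    MvPolynomial.eval (Sum.elim y w) p ^ a * MvPolynomial.eval (Sum.elim y x) p ^ b ≤
      MvPolynomial.eval (Sum.elim y (a • w + b • x)) p := by
  rcases eq_or_ne p 0 with rfl | hp0
  · simp [Real.zero_rpow ha.ne']
  simp only [← eval_partialEval]
  have hq0 : partialEval y p ≠ 0 := by
    intro h
    have h1 := eval_partialEval y p 1
    rw [h, map_zero] at h1
    refine (eval_pos_of_coeff_nonneg hp0 hc fun i => ?_).ne h1
    cases i with
    | inl j => exact hy j
    | inr j => simp
  have hqc := coeff_partialEval_nonneg (fun i => (hy i).le) hc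
  have hcont : ∀ u : ι → ℝ, Continuous fun r : ℝ =>
      MvPolynomial.eval (fun i => u i + r) (partialEval y p) := fun u =>
    (MvPolynomial.continuous_eval _).comp (by fun_prop)
  -- Shifting by r moves nonnegative points into the open orthant, and commutes with the convex
  -- combination since a + b = 1.
  have key : ∀ r : ℝ, 0 < r →
      MvPolynomial.eval (fun i => w i + r) (partialEval y p) ^ a *
        MvPolynomial.eval (fun i => x i + r) (partialEval y p) ^ b ≤
      MvPolynomial.eval (fun i => (a • w + b • x) i + r) (partialEval y p) := by
    intro r hr
    have h := _root_.rpow_eval_mul_rpow_eval_le hq0 hqc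
      (hp.aeval_partialEval_ne_zero hp0 hc hy)
      (x := fun i => w i + r) (y := fun i => x i + r) (fun i => by linarith [hw i])
      (fun i => by linarith [hx i]) ha hb hab
    convert h using 3
    ext i
    simp only [Pi.add_apply, Pi.smul_apply, smul_eq_mul]
    linear_combination -r * hab
  have hlim := le_of_tendsto_of_tendsto
    (((((hcont w).rpow_const fun _ => Or.inr ha.le).mul
      ((hcont x).rpow_const fun _ => Or.inr hb.le)).tendsto 0).mono_left nhdsWithin_le_nhds)
    (((hcont (a • w + b • x)).tendsto 0).mono_left nhdsWithin_le_nhds)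
    (eventually_nhdsWithin_of_forall (s := Set.Ioi 0) key)
  simp only [Pi.mul_apply, add_zero] at hlim
  exact hlim

/-! ### Exponential coordinates -/

theorem eval_smul_le {σ : Type*} [Fintype σ] {p : MvPolynomial σ ℝ} (hc : ∀ m, 0 ≤ p.coeff m)
    {w : σ → ℝ} (hw : ∀ i, 0 ≤ w i) {t : ℝ} (ht : 1 ≤ t) :
    MvPolynomial.eval (t • w) p ≤ t ^ p.totalDegree * MvPolynomial.eval w p := by
  rw [MvPolynomial.eval_eq', MvPolynomial.eval_eq', Finset.mul_sum]
  refine Finset.sum_le_sum fun m hm => ?_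
  have h1 : m.degree ≤ p.totalDegree := by
    simpa [Finsupp.degree_eq_sum, Finsupp.sum_fintype] using MvPolynomial.le_totalDegree hm
  have h2 : 0 ≤ p.coeff m * ∏ i, w i ^ m i :=
    mul_nonneg (hc m) (Finset.prod_nonneg fun i _ => pow_nonneg (hw i) _)
  calc p.coeff m * ∏ i, (t • w) i ^ m i = t ^ m.degree * (p.coeff m * ∏ i, w i ^ m i) := by
        simp only [Pi.smul_apply, smul_eq_mul, mul_pow, Finset.prod_mul_distrib,
          Finset.prod_pow_eq_pow_sum, ← Finsupp.degree_eq_sum]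
        ring
    _ ≤ _ := mul_le_mul_of_nonneg_right (pow_le_pow_right₀ ht h1) h2

/-- The quotient `p(y, z) / (y z / α) ^ α` in the coordinates `y = exp u`, `z = α exp v`. -/
noncomputable def expRatio {n : ℕ} (p : MvPolynomial (Fin n ⊕ Fin n) ℝ) (α : Fin n → ℝ)
    (w : (Fin n → ℝ) × (Fin n → ℝ)) : ℝ :=
  MvPolynomial.eval (Sum.elim (fun i => Real.exp (w.1 i)) fun i => α i * Real.exp (w.2 i)) p *
    Real.exp (-∑ i, α i * (w.1 i + w.2 i))

section

variable {n : ℕ} {p : MvPolynomial (Fin n ⊕ Fin n) ℝ}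

theorem expRatio_nonneg (hc : ∀ m, 0 ≤ p.coeff m) {α : Fin n → ℝ} (hα : ∀ i, 0 ≤ α i)
    (w : (Fin n → ℝ) × (Fin n → ℝ)) : 0 ≤ expRatio p α w := by
  refine mul_nonneg (eval_nonneg_of_coeff_nonneg hc fun i => ?_) (Real.exp_pos _).le
  cases i with
  | inl j => exact (Real.exp_pos _).le
  | inr j => exact mul_nonneg (hα j) (Real.exp_pos _).le

theorem continuous_expRatio (p : MvPolynomial (Fin n ⊕ Fin n) ℝ) :
    Continuous fun v : (Fin n → ℝ) × ((Fin n → ℝ) × (Fin n → ℝ)) => expRatio p v.1 v.2 := by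
  simp only [expRatio, MvPolynomial.eval_eq', Fintype.prod_sum_type, Sum.elim_inl, Sum.elim_inr]
  fun_prop

theorem vecPow_mul_div_eq_exp {α u v z : Fin n → ℝ}
    (h : ∀ i, α i ≠ 0 → z i = α i * Real.exp (v i)) :
    vecPow ((fun i => Real.exp (u i)) * z / α) α = Real.exp (∑ i, α i * (u i + v i)) := by
  rw [vecPow, Real.exp_sum]
  refine Finset.prod_congr rfl fun i _ => ?_
  rcases eq_or_ne (α i) 0 with h0 | h0
  · simp [h0]
  · have e : ((fun i => Real.exp (u i)) * z / α) i = Real.exp (u i + v i) := by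
      simp only [Pi.div_apply, Pi.mul_apply, h i h0, Real.exp_add]
      field_simp
    rw [e, ← Real.exp_mul, mul_comm]

theorem ratio_eq_mul_exp {α u v z : Fin n → ℝ} (h : ∀ i, α i ≠ 0 → z i = α i * Real.exp (v i)) :
    ratio p α (fun i => Real.exp (u i)) z =
      MvPolynomial.eval (Sum.elim (fun i => Real.exp (u i)) z) p *
        Real.exp (-∑ i, α i * (u i + v i)) := by
  rw [ratio, vecPow_mul_div_eq_exp h, Real.exp_neg, div_eq_mul_inv]

theorem exists_expRatio_le_ratio (hc : ∀ m, 0 ≤ p.coeff m) {α y z : Fin n → ℝ}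
    (hα : ∀ i, 0 ≤ α i) (hy : ∀ i, 0 < y i) (hz : ∀ i, 0 < z i) :
    ∃ w, expRatio p α w ≤ ratio p α y z := by
  obtain ⟨u, rfl⟩ : ∃ u : Fin n → ℝ, y = fun i => Real.exp (u i) :=
    ⟨fun i => Real.log (y i), funext fun i => (Real.exp_log (hy i)).symm⟩
  have hv : ∀ i, α i ≠ 0 → z i = α i * Real.exp (Real.log (z i / α i)) := fun i hi => by
    rw [Real.exp_log (div_pos (hz i) ((hα i).lt_of_ne' hi))]
    field_simp
  -- Where α_i = 0 the value of v_i is immaterial: `expRatio` then uses z_i = 0, which by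
  -- monotonicity only lowers p.
  refine ⟨(u, fun i => Real.log (z i / α i)), ?_⟩
  rw [ratio_eq_mul_exp hv, expRatio]
  refine mul_le_mul_of_nonneg_right (eval_mono_of_coeff_nonneg hc (fun i => ?_) fun i => ?_)
    (Real.exp_pos _).le
  · cases i with
    | inl j => exact (Real.exp_pos _).le
    | inr j => exact mul_nonneg (hα j) (Real.exp_pos _).le
  · cases i with
    | inl j => exact le_rfl
    | inr j =>
      rcases eq_or_ne (α j) 0 with h | h
      · simpa [h] using (hz j).le
      · exact (hv j h).ge

open Filter Topology in
-- Coordinates with α_i = 0 give z_i = 0, which is not admissible in the infimum; they are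
-- approached by z_i = r → 0⁺.
theorem iInf_ratio_le_expRatio {α : Fin n → ℝ} (hα : ∀ i, 0 ≤ α i) (u v : Fin n → ℝ) :
    ⨅ (z : Fin n → ℝ) (_ : ∀ i, 0 < z i), ((ratio p α (fun i => Real.exp (u i)) z : ℝ) : EReal) ≤
      (expRatio p α (u, v) : ℝ) := by
  have hcont : Continuous fun r : ℝ => ((MvPolynomial.eval (Sum.elim (fun i => Real.exp (u i))
      fun i => α i * Real.exp (v i) + if α i = 0 then r else 0) p *
        Real.exp (-∑ i, α i * (u i + v i)) : ℝ) : EReal) := by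
    refine continuous_coe_real_ereal.comp (((MvPolynomial.continuous_eval p).comp ?_).mul
      continuous_const)
    refine continuous_pi fun i => ?_
    cases i with
    | inl j => exact continuous_const
    | inr j => by_cases h : α j = 0 <;> simp [h] <;> fun_prop
  have hlim := ge_of_tendsto ((hcont.tendsto 0).mono_left nhdsWithin_le_nhds)
    (b := ⨅ (z : Fin n → ℝ) (_ : ∀ i, 0 < z i),
      ((ratio p α (fun i => Real.exp (u i)) z : ℝ) : EReal))
    (eventually_nhdsWithin_of_forall (s := Set.Ioi 0) fun r hr => ?_)
  · simp only [ite_self, add_zero] at hlim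
    exact hlim
  · refine (iInf₂_le (fun i => α i * Real.exp (v i) + if α i = 0 then r else 0) fun i => ?_).trans ?_
    · by_cases h : α i = 0
      · simpa [h] using hr
      · simpa [h] using mul_pos ((hα i).lt_of_ne' h) (Real.exp_pos (v i))
    · rw [ratio_eq_mul_exp (v := v) fun i hi => by simp [hi]]

/-! ### Decay for large α -/

theorem vecPow_update_eq {α y : Fin n → ℝ} (hα : ∀ i, 0 ≤ α i) (hy : ∀ i, 0 < y i) (i : Fin n)
    {t : ℝ} (ht : 0 < t) :
    vecPow (y * Function.update (1 : Fin n → ℝ) i t / α) α = vecPow (y / α) α * t ^ α i := by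
  have h1 : t ^ α i = ∏ j, (Function.update (1 : Fin n → ℝ) i t j) ^ α j := by
    rw [Finset.prod_eq_single i (fun j _ hj => by simp [hj]) (by simp)]
    simp
  have h2 : ∀ j, 0 ≤ Function.update (1 : Fin n → ℝ) i t j := fun j => by
    by_cases hj : j = i
    · subst hj
      simpa using ht.le
    · simp [hj]
  rw [h1, vecPow, vecPow, ← Finset.prod_mul_distrib]
  refine Finset.prod_congr rfl fun j _ => ?_
  rw [Pi.div_apply, Pi.div_apply, Pi.mul_apply,
    ← Real.mul_rpow (div_nonneg (hy j).le (hα j)) (h2 j), mul_div_right_comm]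

theorem vecPow_div_pos {α y : Fin n → ℝ} (hα : ∀ i, 0 ≤ α i) (hy : ∀ i, 0 < y i) :
    0 < vecPow (y / α) α := by
  refine Finset.prod_pos fun j _ => ?_
  rcases eq_or_ne (α j) 0 with h | h
  · simp [h]
  · exact Real.rpow_pos_of_pos (div_pos (hy j) ((hα j).lt_of_ne' h)) _

theorem eval_update_le (hc : ∀ m, 0 ≤ p.coeff m) {y : Fin n → ℝ} (hy : ∀ i, 0 < y i) (i : Fin n)
    {t : ℝ} (ht : 1 ≤ t) :
    MvPolynomial.eval (Sum.elim y (Function.update (1 : Fin n → ℝ) i t)) p ≤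
      t ^ p.totalDegree * MvPolynomial.eval (Sum.elim y 1) p := by
  have hu : ∀ j, 0 ≤ Function.update (1 : Fin n → ℝ) i t j ∧
      Function.update (1 : Fin n → ℝ) i t j ≤ t := fun j => by
    by_cases hj : j = i
    · subst hj
      simpa using zero_le_one.trans ht
    · simpa [hj] using ht
  refine (eval_mono_of_coeff_nonneg hc (fun j => ?_) fun j => ?_).trans
    (eval_smul_le hc (w := Sum.elim y 1) (fun j => ?_) ht)
  · cases j with
    | inl j => exact (hy j).le
    | inr j => exact (hu j).1
  · cases j with
    | inl j => simpa using le_mul_of_one_le_left (hy j).le ht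
    | inr j => simpa using (hu j).2
  · cases j with
    | inl j => exact (hy j).le
    | inr j => simp

/-- With z_i = t and the other z_j equal to 1, the numerator grows at most like t^deg while the
denominator scales exactly like t^{α_i}. -/
theorem ratio_update_le (hc : ∀ m, 0 ≤ p.coeff m) {α y : Fin n → ℝ} (hα : ∀ i, 0 ≤ α i)
    (hy : ∀ i, 0 < y i) (i : Fin n) {t : ℝ} (ht : 1 ≤ t) :
    ratio p α y (Function.update (1 : Fin n → ℝ) i t) ≤
      MvPolynomial.eval (Sum.elim y 1) p / vecPow (y / α) α *
        t ^ (-(α i - p.totalDegree)) := by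
  have ht0 : 0 < t := zero_lt_one.trans_le ht
  have hden : 0 < vecPow (y / α) α * t ^ α i :=
    mul_pos (vecPow_div_pos hα hy) (Real.rpow_pos_of_pos ht0 _)
  rw [ratio, vecPow_update_eq hα hy i ht0, neg_sub, Real.rpow_sub ht0, Real.rpow_natCast,
    div_mul_div_comm, mul_comm (MvPolynomial.eval (Sum.elim y 1) p)]
  exact div_le_div_of_nonneg_right (eval_update_le hc hy i ht) hden.le

open Filter Topology in
theorem iInf_ratio_nonpos (hc : ∀ m, 0 ≤ p.coeff m) {α y : Fin n → ℝ} (hα : ∀ i, 0 ≤ α i)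
    (hy : ∀ i, 0 < y i) {i : Fin n} (hi : p.totalDegree < α i) :
    ⨅ (z : Fin n → ℝ) (_ : ∀ i, 0 < z i), ((ratio p α y z : ℝ) : EReal) ≤ 0 := by
  have hlim : Tendsto (fun t : ℝ => ((MvPolynomial.eval (Sum.elim y 1) p / vecPow (y / α) α *
      t ^ (-(α i - p.totalDegree)) : ℝ) : EReal)) atTop (𝓝 0) := by
    have := (tendsto_rpow_neg_atTop (sub_pos.2 hi)).const_mul
      (MvPolynomial.eval (Sum.elim y 1) p / vecPow (y / α) α)
    rw [mul_zero] at this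
    exact (continuous_coe_real_ereal.tendsto 0).comp this
  refine ge_of_tendsto hlim ((eventually_ge_atTop 1).mono fun t ht => ?_)
  refine (iInf₂_le (Function.update (1 : Fin n → ℝ) i t) fun j => ?_).trans
    (EReal.coe_le_coe_iff.2 (ratio_update_le hc hα hy i ht))
  by_cases hj : j = i
  · subst hj
    simpa using zero_lt_one.trans_le ht
  · simp [hj]

/-! ### Convexity in (u, v), concavity in α, and minimax -/

theorem quasiconvexOn_expRatio (hc : ∀ m, 0 ≤ p.coeff m) {α : Fin n → ℝ} (hα : ∀ i, 0 ≤ α i) :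
    QuasiconvexOn ℝ Set.univ (expRatio p α) := by
  have e : expRatio p α = fun w => ∑ m ∈ p.support, (p.coeff m * ∏ i, α i ^ m (Sum.inr i)) *
      Real.exp (∑ i, (m (Sum.inl i) * w.1 i + m (Sum.inr i) * w.2 i - α i * (w.1 i + w.2 i))) := by
    ext w
    rw [expRatio, MvPolynomial.eval_eq', Finset.sum_mul]
    refine Finset.sum_congr rfl fun m _ => ?_
    rw [Finset.sum_sub_distrib, Finset.sum_add_distrib, sub_eq_add_neg, Real.exp_add, Real.exp_add,
      Real.exp_sum, Real.exp_sum]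
    simp only [Fintype.prod_sum_type, Sum.elim_inl, Sum.elim_inr, mul_pow, Finset.prod_mul_distrib,
      ← Real.exp_nat_mul]
    ring
  rw [e]
  refine ConvexOn.quasiconvexOn ⟨convex_univ, fun w _ w' _ a b ha hb hab => ?_⟩
  rw [smul_eq_mul, smul_eq_mul, Finset.mul_sum, Finset.mul_sum, ← Finset.sum_add_distrib]
  refine Finset.sum_le_sum fun m _ => ?_
  have hk : 0 ≤ p.coeff m * ∏ i, α i ^ m (Sum.inr i) :=
    mul_nonneg (hc m) (Finset.prod_nonneg fun i _ => pow_nonneg (hα i) _)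
  rw [mul_left_comm a, mul_left_comm b, ← mul_add]
  refine mul_le_mul_of_nonneg_left ?_ hk
  refine Eq.trans_le ?_ (convexOn_exp.2 (Set.mem_univ (∑ i, (m (Sum.inl i) * w.1 i +
    m (Sum.inr i) * w.2 i - α i * (w.1 i + w.2 i)))) (Set.mem_univ (∑ i, (m (Sum.inl i) * w'.1 i +
    m (Sum.inr i) * w'.2 i - α i * (w'.1 i + w'.2 i)))) ha hb hab)
  congr 1
  rw [smul_eq_mul, smul_eq_mul, Finset.mul_sum, Finset.mul_sum, ← Finset.sum_add_distrib]
  refine Finset.sum_congr rfl fun i _ => ?_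
  simp only [Prod.fst_add, Prod.snd_add, Prod.smul_fst, Prod.smul_snd, Pi.add_apply, Pi.smul_apply,
    smul_eq_mul]
  ring

/-- The point α e^v is linear in α and the exponential factor is log-linear in α, so log-concavity
of p(y, ·) carries over to `expRatio`. -/
theorem IsBistable.quasiconcaveOn_expRatio (hp : IsBistable p) (hc : ∀ m, 0 ≤ p.coeff m)
    {K : Set (Fin n → ℝ)} (hK : Convex ℝ K) (hK0 : ∀ α ∈ K, ∀ i, 0 ≤ α i)
    (w : (Fin n → ℝ) × (Fin n → ℝ)) : QuasiconcaveOn ℝ K fun α => expRatio p α w := by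
  intro c
  -- For c ≤ 0 the superlevel set is all of K; only c > 0 allows the splitting c = c^a c^b.
  rcases le_or_gt c 0 with h0 | h0
  · convert hK using 1
    ext α
    exact ⟨fun h => h.1, fun h => ⟨h, h0.trans (expRatio_nonneg hc (hK0 α h) w)⟩⟩
  rw [convex_iff_forall_pos]
  rintro α ⟨hα, hcα⟩ β ⟨hβ, hcβ⟩ a b ha hb hab
  refine ⟨hK hα hβ ha.le hb.le hab, ?_⟩
  have hmul : ∀ α ∈ K, 0 ≤ MvPolynomial.eval (Sum.elim (fun i => Real.exp (w.1 i))
      fun i => α i * Real.exp (w.2 i)) p := fun α hα =>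
    eval_nonneg_of_coeff_nonneg hc fun i => by
      cases i with
      | inl j => exact (Real.exp_pos _).le
      | inr j => exact mul_nonneg (hK0 α hα j) (Real.exp_pos _).le
  have h1 := hp.rpow_eval_mul_rpow_eval_le hc (y := fun i => Real.exp (w.1 i))
    (fun i => Real.exp_pos _) (w := fun i => α i * Real.exp (w.2 i))
    (x := fun i => β i * Real.exp (w.2 i))
    (fun i => mul_nonneg (hK0 α hα i) (Real.exp_pos _).le)
    (fun i => mul_nonneg (hK0 β hβ i) (Real.exp_pos _).le) ha hb hab
  calc c = c ^ a * c ^ b := by rw [← Real.rpow_add h0, hab, Real.rpow_one]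
    _ ≤ expRatio p α w ^ a * expRatio p β w ^ b :=
        mul_le_mul (Real.rpow_le_rpow h0.le hcα ha.le) (Real.rpow_le_rpow h0.le hcβ hb.le)
          (Real.rpow_nonneg h0.le _) (Real.rpow_nonneg (expRatio_nonneg hc (hK0 α hα) w) _)
    _ = (MvPolynomial.eval (Sum.elim (fun i => Real.exp (w.1 i))
          fun i => α i * Real.exp (w.2 i)) p ^ a * MvPolynomial.eval (Sum.elim
          (fun i => Real.exp (w.1 i)) fun i => β i * Real.exp (w.2 i)) p ^ b) *
          Real.exp (-∑ i, (a • α + b • β) i * (w.1 i + w.2 i)) := by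
        rw [expRatio, expRatio, Real.mul_rpow (hmul α hα) (Real.exp_pos _).le,
          Real.mul_rpow (hmul β hβ) (Real.exp_pos _).le, ← Real.exp_mul, ← Real.exp_mul,
          mul_mul_mul_comm, ← Real.exp_add]
        congr 2
        simp only [← Finset.sum_neg_distrib, Finset.sum_mul, ← Finset.sum_add_distrib]
        refine Finset.sum_congr rfl fun i _ => ?_
        simp only [Pi.add_apply, Pi.smul_apply, smul_eq_mul]
        ring
    _ ≤ expRatio p (a • α + b • β) w := by
        refine mul_le_mul_of_nonneg_right (h1.trans_eq ?_) (Real.exp_pos _).le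
        congr 3
        ext i
        simp only [Pi.add_apply, Pi.smul_apply, smul_eq_mul]
        ring

theorem IsBistable.iSup_iInf_expRatio_eq (hp : IsBistable p) (hc : ∀ m, 0 ≤ p.coeff m)
    {K : Set (Fin n → ℝ)} (hKc : IsCompact K) (hKn : K.Nonempty) (hK : Convex ℝ K)
    (hK0 : ∀ α ∈ K, ∀ i, 0 ≤ α i) :
    ⨆ α ∈ K, ⨅ w ∈ Set.univ, ((expRatio p α w : ℝ) : EReal) =
      ⨅ w ∈ Set.univ, ⨆ α ∈ K, ((expRatio p α w : ℝ) : EReal) := by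
  have hcont : Continuous fun v : (Fin n → ℝ) × ((Fin n → ℝ) × (Fin n → ℝ)) =>
      ((expRatio p v.1 v.2 : ℝ) : EReal) := continuous_coe_real_ereal.comp (continuous_expRatio p)
  have hmono : Monotone ((↑) : ℝ → EReal) := EReal.coe_strictMono.monotone
  -- Dualizing the order lets the compact variable α be the one that is maximized.
  refine Sion.minimax' (β := ERealᵒᵈ) (f := fun α w => OrderDual.toDual (expRatio p α w : EReal))
    hKn hK hKc (fun w _ => ?_) (fun w _ => ?_) convex_univ (fun α _ => ?_) fun α hα => ?_
  · exact (continuous_toDual.comp (hcont.comp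
      (Continuous.prodMk_left w))).lowerSemicontinuous.lowerSemicontinuousOn _
  · exact ((hp.quasiconcaveOn_expRatio hc hK hK0 w).monotone_comp hmono).dual
  · exact (continuous_toDual.comp (hcont.comp
      (Continuous.prodMk_right α))).upperSemicontinuous.upperSemicontinuousOn _
  · exact ((quasiconvexOn_expRatio hc (hK0 α hα)).monotone_comp hmono).dual

end

/-! ### The minimax identity -/

theorem mainTheorem5 (n : ℕ) (p : MvPolynomial (Fin n ⊕ Fin n) ℝ)
    (hp : IsBistable p) (hcoeff : ∀ m, 0 ≤ p.coeff m) :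
    (⨆ (α : Fin n → ℝ) (_ : ∀ i, 0 ≤ α i),
      ⨅ (y : Fin n → ℝ) (_ : ∀ i, 0 < y i) (z : Fin n → ℝ) (_ : ∀ i, 0 < z i),
        ((ratio p α y z : ℝ) : EReal)) =
    ⨅ (y : Fin n → ℝ) (_ : ∀ i, 0 < y i),
      ⨆ (α : Fin n → ℝ) (_ : ∀ i, 0 ≤ α i),
        ⨅ (z : Fin n → ℝ) (_ : ∀ i, 0 < z i),
          ((ratio p α y z : ℝ) : EReal) := by
  apply le_antisymm
  · refine iSup₂_le fun α hα => le_iInf₂ fun y hy => ?_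
    exact (iInf₂_le y hy).trans (le_iSup₂_of_le α hα le_rfl)
  set K : Set (Fin n → ℝ) := Set.Icc 0 fun _ => (p.totalDegree : ℝ) with hK
  have hKn : K.Nonempty := Set.nonempty_Icc.2 fun _ => Nat.cast_nonneg _
  have hK0 : ∀ α ∈ K, ∀ i, 0 ≤ α i := fun α hα => hα.1
  calc _ ≤ ⨅ w ∈ Set.univ, ⨆ α ∈ K, ((expRatio p α w : ℝ) : EReal) := by
        refine le_iInf₂ fun w _ => (iInf₂_le (fun i => Real.exp (w.1 i))
          fun i => Real.exp_pos _).trans (iSup₂_le fun α hα => ?_)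
        by_cases hαK : α ∈ K
        · exact (iInf_ratio_le_expRatio hα w.1 w.2).trans
            (le_iSup₂ (f := fun α (_ : α ∈ K) => ((expRatio p α w : ℝ) : EReal)) α hαK)
        · obtain ⟨i, hi⟩ : ∃ i, (p.totalDegree : ℝ) < α i := by
            by_contra! h
            exact hαK ⟨hα, h⟩
          -- Outside the box the infimum is at most 0, hence below the nonnegative value at any β in
          -- the box.
          obtain ⟨β, hβ⟩ := hKn
          refine (iInf_ratio_nonpos hcoeff hα (fun i => Real.exp_pos _) hi).trans ?_
          exact le_iSup₂_of_le β hβ (EReal.coe_nonneg.2 (expRatio_nonneg hcoeff (hK0 β hβ) w))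
    _ = ⨆ α ∈ K, ⨅ w ∈ Set.univ, ((expRatio p α w : ℝ) : EReal) :=
        (hp.iSup_iInf_expRatio_eq hcoeff isCompact_Icc hKn (convex_Icc _ _) hK0).symm
    _ ≤ _ := by
        refine iSup₂_le fun α hα => le_iSup₂_of_le α (hK0 α hα) (le_iInf₂ fun y hy =>
          le_iInf₂ fun z hz => ?_)
        obtain ⟨w, hw⟩ := exists_expRatio_le_ratio hcoeff (hK0 α hα) hy hz
        exact (iInf₂_le w (Set.mem_univ w)).trans (EReal.coe_le_coe_iff.2 hw)
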